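/- Let $(F_k)_{k\ge 1}$ be the Fibonacci sequence, $F_1=F_2=1$ and $F_{k+2}=F_{k+1}+F_k$, and for every integer $n\ge 1$ put $a_n=\prod_{k=1}^{n}F_k$. Let $$C=\Bigl\{\sum_{j=1}^{\infty}\frac{d_j}{3^j} : d_j\in\{0,2\}\text{ for all } j\ge 1\Bigr\}$$ be the standard middle-third Cantor set. Then $$\Bigl\{\frac1{a_n} : n\ge 1\Bigr\}\cap C=\Bigl\{1,\frac1{30}\Bigr\};$$ more precisely, for every integer $n\ge 1$, $$\frac1{a_n}\in C\iff n\in\{1,2,5\}.$$ -/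

import Mathlib

/-- The missing-digit set `K_{m,D}`: all reals `∑_{j ≥ 1} a_j / m ^ j` with every digit `a_j` in `D`.
The sequence is indexed from `0` here, so `a j` is the digit in position `j + 1`. -/
def missingDigitSet (m : ℕ) (D : Set ℕ) : Set ℝ :=
  {x | ∃ a : ℕ → ℕ, (∀ j, a j ∈ D) ∧ HasSum (fun j => (a j : ℝ) / (m : ℝ) ^ (j + 1)) x}

/-- The set `K_{3,{0,2}}` is Mathlib's middle-third Cantor set. -/
theorem missingDigitSet_three_eq_cantorSet : missingDigitSet 3 {0, 2} = cantorSet := by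
  rw [cantorSet_eq_zero_two_ofDigits]
  ext x
  constructor
  · rintro ⟨a, ha, hx⟩
    have hlt : ∀ j, a j < 3 := fun j => by
      rcases ha j with h | h <;> rw [h] <;> norm_num
    refine ⟨fun j => ⟨a j, hlt j⟩, fun j h => ?_, ?_⟩
    · have h1 : a j = 1 := congrArg Fin.val h
      rcases ha j with h | h <;> rw [h] at h1 <;> norm_num at h1
    · rw [Real.ofDigits, ← hx.tsum_eq]
      simp [Real.ofDigitsTerm, div_eq_mul_inv]
  · rintro ⟨a, ha, rfl⟩
    refine ⟨fun j => (a j : ℕ), fun j => ?_, ?_⟩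
    · have h : (a j : ℕ) ≠ 1 := fun h => ha j (Fin.ext h)
      have h3 := (a j).isLt
      change (a j : ℕ) = 0 ∨ (a j : ℕ) = 2
      omega
    · have h := (Real.summable_ofDigitsTerm (digits := a)).hasSum
      rw [Real.ofDigits]
      convert h using 2 with j
      simp [Real.ofDigitsTerm, div_eq_mul_inv]

/-! Tripling modulo 1 preserves `cantorSet` up to endpoints, so `1 / N` is excluded once some `3 ^ k
/ N` has fractional part in `(1/3, 2/3)` (`one_div_notMem_cantorSet`). Write `N = 2 ^ a * 3 ^ v * m`
with `m` prime to 6. If `2 ^ a` is large compared with every prime factor of `N`, the order of 3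
modulo `2 ^ a` contains a higher power of 2 than its order modulo `m`. Some `3 ^ K` is then 1 modulo
`m` but `1 + 2 ^ (a - 1)` modulo `2 ^ a`, and `3 ^ (K + v) / N` falls just above a half-integer. For
`N = fibProd n`, the exponent of 2 grows at least like `3n/4`, while prime factors are at most
`F_n`, and `log₂ φ < 3/4`; this settles `n ≥ 72`. Smaller `n` are computed. -/

/-- The product `F₁ F₂ ⋯ Fₙ` of the first `n` Fibonacci numbers. -/
def fibProd (n : ℕ) : ℕ := ∏ k ∈ Finset.Icc 1 n, Nat.fib k

lemma fibProd_succ (n : ℕ) : fibProd (n + 1) = fibProd n * Nat.fib (n + 1) :=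
  Finset.prod_Icc_succ_top (by omega) _

lemma fibProd_ne_zero (n : ℕ) : fibProd n ≠ 0 :=
  Finset.prod_ne_zero_iff.mpr fun _ hk =>
    (Nat.fib_pos.mpr (Finset.mem_Icc.mp hk).1).ne'

/-! ### The Cantor set and multiplication by three -/

lemma exists_nat_add_of_mem_cantorSet {x : ℝ} (hx : x ∈ cantorSet) (k : ℕ) :
    ∃ m : ℕ, ∃ y ∈ cantorSet, 3 ^ k * x = m + y := by
  induction k with
  | zero => exact ⟨0, x, hx, by simp⟩
  | succ k ih =>
    obtain ⟨m, y, hy, h⟩ := ih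
    rw [cantorSet_eq_union_halves] at hy
    rcases hy with ⟨z, hz, hzy⟩ | ⟨z, hz, hzy⟩
    · refine ⟨3 * m, z, hz, ?_⟩
      simp only at hzy
      push_cast
      rw [pow_succ]
      linarith
    · refine ⟨3 * m + 2, z, hz, ?_⟩
      simp only at hzy
      push_cast
      rw [pow_succ]
      linarith

lemma not_mem_middle_third_of_mem_cantorSet {y : ℝ} (hy : y ∈ cantorSet) :
    ¬ (1 / 3 < y ∧ y < 2 / 3) := by
  rintro ⟨h1, h2⟩
  rw [cantorSet_eq_union_halves] at hy
  rcases hy with ⟨z, hz, hzy⟩ | ⟨z, hz, hzy⟩ <;>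
  · have := cantorSet_subset_unitInterval hz
    simp only at hzy
    linarith [this.1, this.2]

lemma one_div_notMem_cantorSet {N k q r : ℕ} (h : 3 ^ k = q * N + r) (h1 : N < 3 * r)
    (h2 : 3 * r < 2 * N) : (1 / N : ℝ) ∉ cantorSet := by
  intro hx
  obtain ⟨m, y, hy, hmy⟩ := exists_nat_add_of_mem_cantorSet hx k
  have hN : (0 : ℝ) < N := by
    have : 0 < N := by omega
    exact_mod_cast this
  have h' : (3 : ℝ) ^ k = q * N + r := by exact_mod_cast h
  have h1' : (N : ℝ) < 3 * r := by exact_mod_cast h1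
  have h2' : 3 * (r : ℝ) < 2 * N := by exact_mod_cast h2
  have hr1 : 1 / 3 < (r : ℝ) / N := by rw [lt_div_iff₀ hN]; linarith
  have hr2 : (r : ℝ) / N < 2 / 3 := by rw [div_lt_iff₀ hN]; linarith
  have he : (q : ℝ) + r / N = m + y := by
    rw [← hmy, h']
    field_simp
  have hy01 := cantorSet_subset_unitInterval hy
  have hq : q = m := by
    have ha : (q : ℝ) < m + 1 := by linarith [hy01.2]
    have hb : (m : ℝ) < q + 1 := by linarith [hy01.1]
    have ha' : q < m + 1 := by exact_mod_cast ha
    have hb' : m < q + 1 := by exact_mod_cast hb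
    omega
  subst hq
  have hyr : y = r / N := by linarith
  exact not_mem_middle_third_of_mem_cantorSet hy (hyr ▸ ⟨hr1, hr2⟩)

/-- Tripling modulo 1 cycles 1/10 → 3/10 → 9/10 → 7/10 → 1/10, so the four memberships need a joint
induction. -/
lemma tenths_mem_preCantorSet (n : ℕ) :
    (1 / 10 : ℝ) ∈ preCantorSet n ∧ (3 / 10 : ℝ) ∈ preCantorSet n ∧
      (7 / 10 : ℝ) ∈ preCantorSet n ∧ (9 / 10 : ℝ) ∈ preCantorSet n := by
  induction n with
  | zero => simp only [preCantorSet_zero, Set.mem_Icc]; norm_num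
  | succ n ih =>
    exact ⟨Or.inl ⟨3 / 10, ih.2.1, by norm_num⟩, Or.inl ⟨9 / 10, ih.2.2.2, by norm_num⟩,
      Or.inr ⟨1 / 10, ih.1, by norm_num⟩, Or.inr ⟨7 / 10, ih.2.2.1, by norm_num⟩⟩

lemma one_div_thirty_mem_cantorSet : (1 / 30 : ℝ) ∈ cantorSet := by
  rw [cantorSet_eq_union_halves]
  exact Or.inl ⟨1 / 10, Set.mem_iInter.mpr fun n => (tenths_mem_preCantorSet n).1, by norm_num⟩

lemma one_mem_cantorSet : (1 : ℝ) ∈ cantorSet := by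
  refine Set.mem_iInter.mpr fun n => ?_
  induction n with
  | zero => simp
  | succ n ih => exact Or.inr ⟨1, ih, by norm_num⟩

/-! ### Powers of three modulo numbers with a large power of two -/

/-- Each squaring raises the 2-adic valuation of `3 ^ k - 1` by exactly one; the start is `9 * 81 ^
s ≡ 9` modulo 16. -/
lemma exists_three_pow_eq {u : ℕ} (hu : Odd u) (c : ℕ) :
    ∃ w, Odd w ∧ 3 ^ (u * 2 ^ (c + 1)) = 1 + 2 ^ (c + 3) * w := by
  induction c with
  | zero =>
    obtain ⟨s, rfl⟩ := hu
    have h : 3 ^ ((2 * s + 1) * 2 ^ (0 + 1)) % 16 = 9 := by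
      rw [show 3 ^ ((2 * s + 1) * 2 ^ (0 + 1)) = 81 ^ s * 9 by
        rw [show (2 * s + 1) * 2 ^ (0 + 1) = 4 * s + 2 by ring, pow_add, pow_mul]; norm_num]
      rw [Nat.mul_mod, Nat.pow_mod]
      norm_num
    refine ⟨2 * (3 ^ ((2 * s + 1) * 2 ^ (0 + 1)) / 16) + 1, ⟨_, rfl⟩, ?_⟩
    omega
  | succ c ih =>
    obtain ⟨w, hw, h⟩ := ih
    refine ⟨w * (1 + 2 ^ (c + 2) * w), hw.mul ?_, ?_⟩
    · rw [pow_succ]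
      exact ⟨2 ^ (c + 1) * w, by ring⟩
    · rw [pow_succ 2 (c + 1), ← mul_assoc, pow_mul, h]
      ring

/-- If no prime factor `p` of `m` satisfies `2 ^ (b + 1) ∣ p - 1`, then the order of `3` modulo `m`
is not divisible by `2 ^ (b + 1)`. -/
lemma exists_odd_three_pow_modEq_one {m b : ℕ} (hm : m ≠ 0) (h2 : ¬ 2 ∣ m) (h3 : ¬ 3 ∣ m)
    (hb : ∀ p, p.Prime → p ∣ m → ¬ 2 ^ (b + 1) ∣ p - 1) :
    ∃ u, Odd u ∧ m ∣ 3 ^ (u * 2 ^ b) - 1 := by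
  obtain ⟨e, u, hu, hphi⟩ :=
    Nat.exists_eq_two_pow_mul_odd (Nat.totient_pos.mpr (Nat.pos_of_ne_zero hm)).ne'
  -- Here `u` is the odd part of `φ(m)`. It suffices that `φ(p ^ k)` divides `u * 2 ^ b` for each
  -- prime power dividing `m`.
  refine ⟨u, hu, (Nat.dvd_iff_prime_pow_dvd_dvd _ _).mpr fun p k hp hpk => ?_⟩
  rcases Nat.eq_zero_or_pos k with rfl | hk
  · simp
  have hpm : p ∣ m := (dvd_pow_self p hk.ne').trans hpk
  have hp2 : p ≠ 2 := fun h => h2 (h ▸ hpm)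
  have hp3 : p ≠ 3 := fun h => h3 (h ▸ hpm)
  have hco : Nat.Coprime 3 (p ^ k) :=
    Nat.Coprime.pow_right _ ((Nat.coprime_primes Nat.prime_three hp).mpr hp3.symm)
  have hdvd : Nat.totient (p ^ k) ∣ u * 2 ^ b := by
    obtain ⟨s, t, ht, hst⟩ :=
      Nat.exists_eq_two_pow_mul_odd (Nat.totient_pos.mpr (pow_pos hp.pos k)).ne'
    have htu : t ∣ u := by
      have h1 : t ∣ 2 ^ e * u := by
        rw [← hphi]
        exact (Dvd.intro_left _ hst.symm).trans (Nat.totient_dvd_of_dvd hpk)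
      exact (Nat.Coprime.pow_right e (Nat.coprime_two_right.mpr ht)).dvd_of_dvd_mul_left h1
    have hsb : s ≤ b := by
      by_contra hsb
      apply hb p hp hpm
      have h1 : 2 ^ (b + 1) ∣ p ^ (k - 1) * (p - 1) := by
        rw [← Nat.totient_prime_pow hp hk, hst]
        exact (pow_dvd_pow 2 (by omega)).mul_right t
      refine Nat.Coprime.dvd_of_dvd_mul_left (Nat.Coprime.pow _ _ ?_) h1
      exact (Nat.coprime_primes Nat.prime_two hp).mpr hp2.symm
    rw [hst, mul_comm]
    exact mul_dvd_mul htu (pow_dvd_pow 2 hsb)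
  obtain ⟨t, ht⟩ := hdvd
  rw [ht, pow_mul]
  have := ((Nat.ModEq.pow_totient hco).pow t).symm
  rw [one_pow] at this
  exact (Nat.modEq_iff_dvd' (Nat.one_le_pow _ _ (by positivity))).mp this

/-- If `2 ^ (e + 4)` divides `N` and no prime factor of `N` exceeds `2 ^ (e + 2)`,
then some power of `3` times `1 / N` is, modulo `1`, in the removed middle third. -/
lemma one_div_notMem_cantorSet_of_two_pow_dvd {N e : ℕ} (hN : N ≠ 0) (he : 2 ^ (e + 4) ∣ N)
    (hp : ∀ p, p.Prime → p ∣ N → p ≤ 2 ^ (e + 2)) : (1 / N : ℝ) ∉ cantorSet := by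
  obtain ⟨a, m', hm', rfl⟩ := Nat.exists_eq_pow_mul_and_not_dvd hN 2 (by norm_num)
  have hm'0 : m' ≠ 0 := fun h => hN (by simp [h])
  obtain ⟨v, m, hm, rfl⟩ := Nat.exists_eq_pow_mul_and_not_dvd hm'0 3 (by norm_num)
  have hm0 : m ≠ 0 := fun h => hN (by simp [h])
  have hm2 : ¬ 2 ∣ m := fun h => hm' (h.mul_left _)
  have hea : e + 4 ≤ a := by
    have h1 : Nat.Coprime (2 ^ (e + 4)) (3 ^ v * m) :=
      Nat.Coprime.pow_left _ ((Nat.prime_two.coprime_iff_not_dvd).mpr hm')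
    exact (Nat.pow_dvd_pow_iff_le_right (by norm_num)).mp (h1.dvd_of_dvd_mul_right he)
  obtain ⟨c, rfl⟩ := Nat.exists_eq_add_of_le hea
  -- With `a = e + 4 + c`, the factor `2 ^ (e + c + 1)` is half the order `2 ^ (a - 2)` of 3 modulo
  -- `2 ^ a`.
  obtain ⟨u, hu, hmu⟩ : ∃ u, Odd u ∧ m ∣ 3 ^ (u * 2 ^ (e + c + 1)) - 1 := by
    refine exists_odd_three_pow_modEq_one hm0 hm2 hm fun p hpp hpm hdvd => ?_
    have h1 := hp p hpp ((hpm.mul_left _).mul_left _)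
    have h2 := Nat.le_of_dvd (by have := hpp.two_le; omega) hdvd
    have h3 : 2 ^ (e + 2) ≤ 2 ^ (e + c + 1 + 1) := Nat.pow_le_pow_right (by norm_num) (by omega)
    have := hpp.two_le
    omega
  obtain ⟨w, hw, h3⟩ := exists_three_pow_eq hu (e + c)
  have hmw : m ∣ w := by
    rw [h3, Nat.add_sub_cancel_left] at hmu
    refine Nat.Coprime.dvd_of_dvd_mul_left (Nat.Coprime.pow_right _ ?_) hmu
    exact ((Nat.prime_two.coprime_iff_not_dvd).mpr hm2).symm
  obtain ⟨t, rfl⟩ := hmw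
  obtain ⟨s, rfl⟩ := (Nat.odd_mul.mp hw).2
  -- Here `r / N = 1/2 + 1/(2 ^ a * m)`, below 2/3 because `2 ^ a ≥ 16`.
  refine one_div_notMem_cantorSet (k := u * 2 ^ (e + c + 1) + v) (q := s)
    (r := 3 ^ v + 2 ^ (e + c + 3) * (3 ^ v * m)) ?_ ?_ ?_
  · rw [pow_add, h3]
    ring
  · have h4 : 2 ^ (e + 4 + c) * (3 ^ v * m) = 2 * (2 ^ (e + c + 3) * (3 ^ v * m)) := by ring
    rw [h4]
    have : 0 < 2 ^ (e + c + 3) * (3 ^ v * m) := by positivity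
    have : 0 < 3 ^ v := by positivity
    omega
  · have h4 : 2 ^ (e + 4 + c) * (3 ^ v * m) = 2 * (2 ^ (e + c + 3) * (3 ^ v * m)) := by ring
    rw [h4]
    have h5 : 3 ^ v ≤ 3 ^ v * m := Nat.le_mul_of_pos_right _ (Nat.pos_of_ne_zero hm0)
    have h6 : 2 ^ 3 * (3 ^ v * m) ≤ 2 ^ (e + c + 3) * (3 ^ v * m) :=
      Nat.mul_le_mul_right _ (Nat.pow_le_pow_right (by norm_num) (by omega))
    have : 0 < 3 ^ v := by positivity
    omega

/-! ### Products of Fibonacci numbers -/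

/-- `F_3 = 2`, `F_6 = 8` and `F_12 = 144` contribute 1, 3 and 4 factors of 2 to every `F_k` with
index divisible by 3, 6 and 12. -/
lemma two_pow_dvd_fibProd (n : ℕ) : 2 ^ (n / 3 + 2 * (n / 6) + n / 12) ∣ fibProd n := by
  induction n with
  | zero => simp
  | succ n ih =>
    have key : ∀ d j, d ∣ n + 1 → 2 ^ j ∣ Nat.fib d →
        (n + 1) / 3 + 2 * ((n + 1) / 6) + (n + 1) / 12 = n / 3 + 2 * (n / 6) + n / 12 + j →
        2 ^ ((n + 1) / 3 + 2 * ((n + 1) / 6) + (n + 1) / 12) ∣ fibProd (n + 1) := by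
      intro d j hd hj hs
      rw [hs, pow_add, fibProd_succ]
      exact mul_dvd_mul ih (hj.trans (Nat.fib_dvd _ _ hd))
    by_cases h12 : 12 ∣ n + 1
    · exact key 12 4 h12 (by decide) (by omega)
    by_cases h6 : 6 ∣ n + 1
    · exact key 6 3 h6 (by decide) (by omega)
    by_cases h3 : 3 ∣ n + 1
    · exact key 3 1 h3 (by decide) (by omega)
    · exact key 1 0 (one_dvd _) (by decide) (by omega)

lemma fib_add_twelve_le (n : ℕ) (hn : 1 ≤ n) : Nat.fib (n + 12) ≤ 2 ^ 9 * Nat.fib n := by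
  obtain ⟨n, rfl⟩ := Nat.exists_eq_add_of_le' hn
  have h := Nat.fib_add n 12
  have h1 : Nat.fib (n + 2) = Nat.fib n + Nat.fib (n + 1) := Nat.fib_add_two
  have h2 : Nat.fib n ≤ Nat.fib (n + 1) := Nat.fib_le_fib_succ
  rw [show n + 1 + 12 = n + 12 + 1 by ring, h, show Nat.fib 12 = 144 by decide,
    show Nat.fib (12 + 1) = 233 by decide]
  omega

/-- Twelve steps add 9 to the exponent and multiply `F_n` by at most `2 ^ 9`. The bound fails at 71.
-/
lemma four_mul_fib_le (n : ℕ) (hn : 72 ≤ n) :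
    4 * Nat.fib n ≤ 2 ^ (n / 3 + 2 * (n / 6) + n / 12) := by
  induction n using Nat.strong_induction_on with
  | _ n ih =>
    rcases lt_or_ge n 84 with h | h
    · have base : ∀ i < 12, 4 * Nat.fib (72 + i) ≤
          2 ^ ((72 + i) / 3 + 2 * ((72 + i) / 6) + (72 + i) / 12) := by decide +kernel
      have := base (n - 72) (by omega)
      rwa [show 72 + (n - 72) = n by omega] at this
    · obtain ⟨m, rfl⟩ := Nat.exists_eq_add_of_le' (show 12 ≤ n by omega)
      have h1 := ih m (by omega) (by omega)
      have h2 := fib_add_twelve_le m (by omega)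
      rw [show (m + 12) / 3 + 2 * ((m + 12) / 6) + (m + 12) / 12 =
        m / 3 + 2 * (m / 6) + m / 12 + 9 by omega, pow_add]
      omega

lemma one_div_fibProd_notMem_of_le {n : ℕ} (hn : 72 ≤ n) :
    (1 / fibProd n : ℝ) ∉ cantorSet := by
  obtain ⟨e, he⟩ := Nat.exists_eq_add_of_le' (show 4 ≤ n / 3 + 2 * (n / 6) + n / 12 by omega)
  refine one_div_notMem_cantorSet_of_two_pow_dvd (e := e) (fibProd_ne_zero n)
    (he ▸ two_pow_dvd_fibProd n) fun p hp hpn => ?_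
  obtain ⟨k, hk, hpk⟩ := (hp.prime.dvd_finsetProd_iff _).mp hpn
  rw [Finset.mem_Icc] at hk
  have h1 := Nat.le_of_dvd (Nat.fib_pos.mpr hk.1) hpk
  have h2 := Nat.fib_mono hk.2
  have h3 := four_mul_fib_le n hn
  rw [he, show e + 4 = e + 2 + 2 by ring, pow_add] at h3
  omega

/-- As `53/84 ≈ log₃ 2`, the search starts near `log₃ (fibProd n)`; much smaller powers of 3 leave a
remainder below a third. -/
lemma exists_three_pow_mod_fibProd (n : ℕ) (hn : n < 72) (h : 3 ≤ n) (h5 : n ≠ 5) :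
    ∃ j < 20, fibProd n < 3 * (3 ^ (Nat.log2 (fibProd n) * 53 / 84 + j) % fibProd n) ∧
      3 * (3 ^ (Nat.log2 (fibProd n) * 53 / 84 + j) % fibProd n) < 2 * fibProd n := by
  revert n
  decide +kernel

lemma one_div_fibProd_mem_cantorSet_iff {n : ℕ} (hn : 1 ≤ n) :
    (1 / fibProd n : ℝ) ∈ cantorSet ↔ n = 1 ∨ n = 2 ∨ n = 5 := by
  constructor
  · intro h
    by_contra! hne
    rcases lt_or_ge n 72 with hlt | hge
    · obtain ⟨j, -, h1, h2⟩ := exists_three_pow_mod_fibProd n hlt (by omega) hne.2.2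
      exact one_div_notMem_cantorSet (Nat.div_add_mod' _ _).symm h1 h2 h
    · exact one_div_fibProd_notMem_of_le hge h
  · rintro (rfl | rfl | rfl)
    · rw [show fibProd 1 = 1 by decide]
      simpa using one_mem_cantorSet
    · rw [show fibProd 2 = 1 by decide]
      simpa using one_mem_cantorSet
    · rw [show fibProd 5 = 30 by decide]
      exact_mod_cast one_div_thirty_mem_cantorSet

theorem mainTheorem9 :
    {x : ℝ | ∃ n : ℕ, 1 ≤ n ∧ x = 1 / ∏ k ∈ Finset.Icc 1 n, (Nat.fib k : ℝ)} ∩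
        missingDigitSet 3 {0, 2} = {1, 1 / 30} ∧
      ∀ n : ℕ, 1 ≤ n →
        (1 / ∏ k ∈ Finset.Icc 1 n, (Nat.fib k : ℝ) ∈ missingDigitSet 3 {0, 2} ↔
          n ∈ ({1, 2, 5} : Set ℕ)) := by
  have hcast (n : ℕ) : ∏ k ∈ Finset.Icc 1 n, (Nat.fib k : ℝ) = (fibProd n : ℝ) :=
    (Nat.cast_prod _ _).symm
  simp only [hcast, missingDigitSet_three_eq_cantorSet]
  refine ⟨?_, fun n hn => one_div_fibProd_mem_cantorSet_iff hn⟩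
  have h1 : fibProd 1 = 1 := by decide
  have h2 : fibProd 2 = 1 := by decide
  have h5 : fibProd 5 = 30 := by decide
  ext x
  constructor
  · rintro ⟨⟨n, hn, rfl⟩, hx⟩
    rcases (one_div_fibProd_mem_cantorSet_iff hn).mp hx with rfl | rfl | rfl
    · left; simp [h1]
    · left; simp [h2]
    · right; simp [h5]
  · rintro (rfl | rfl)
    · exact ⟨⟨1, le_rfl, by simp [h1]⟩, one_mem_cantorSet⟩
    · exact ⟨⟨5, by norm_num, by simp [h5]⟩, one_div_thirty_mem_cantorSet⟩
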